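/- Let $H$ be a (real or complex) Hilbert space of orthogonal dimension $2^{\aleph_0}$. For a subspace $M$ of an inner product space $E$ write $M^{\perp_E}=\{x\in E:\langle x,m\rangle=0\ \forall m\in M\}$; call $M$ a splitting subspace of $E$ if $M\oplus M^{\perp_E}=E$; and let the orthogonal dimension $\dim E$ of an inner product space $E$ be the common cardinality of its maximal orthonormal systems, i.e. of the orthonormal sets $A\subseteq E$ such that only $0$ is orthogonal to all of $A$. Then there is a linear subspace $S\subseteq H$ with the following properties. 1. $S$ is a dense hyperplane of $H$ (that is, $S$ is dense and $H/S$ has dimension $1$), and $S=\ker f$ for an unbounded linear functional $f$ on $H$. 2. Let $\mathcal U$ be the family of all closed, separable, infinite-dimensional linear subspaces of $H$. Then $A\nsubseteq S$ and $A^{\perp_H}\nsubseteq S$ for every $A\in\mathcal U$; moreover there are vectors $x_A\in A\setminus S$ and $y_A\in A^{\perp_H}\setminus S$ $(A\in\mathcal U)$ such that the family consisting of all the $x_A$ and all the $y_A$ is linearly independent. 3. Every splitting linear subspace $M$ of the inner product space $S$ with countable orthogonal dimension ($\dim M\le\aleph_0$) is finite-dimensional. -/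

import Mathlib

open scoped Cardinal InnerProductSpace

section Defs

variable (𝕜 : Type*) [RCLike 𝕜]

/-- `A` is a maximal orthonormal system (MONS) in the inner product space `E`: its members are
orthonormal, and no nonzero vector of `E` is orthogonal to all of them. A MONS in a linear subspace
`M` is a MONS in the inner product space `↥M`. -/
def IsMONS {E : Type*} [NormedAddCommGroup E] [InnerProductSpace 𝕜 E] (A : Set E) : Prop :=
  Orthonormal 𝕜 ((↑) : A → E) ∧ ∀ x : E, (∀ a ∈ A, ⟪a, x⟫_𝕜 = 0) → x = 0

/-- The orthogonal dimension of the inner product space `E`: the cardinality of a MONS in `E`. All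
of them have the same cardinality, see `IsMONS.mk_eq_orthDim`, and there is one, see
`exists_isMONS`. The orthogonal dimension of a linear subspace `M` is `orthDim 𝕜 ↥M`. -/
noncomputable def orthDim (E : Type*) [NormedAddCommGroup E] [InnerProductSpace 𝕜 E] : Cardinal :=
  sInf {c : Cardinal | ∃ A : Set E, IsMONS 𝕜 A ∧ #A = c}

variable {𝕜}

/-- The linear subspace `M` of the inner product space `E` is splitting: `M ⊕ Mᗮ = E`, where `Mᗮ`
is the orthogonal complement of `M` in `E`. -/
def IsSplitting {E : Type*} [NormedAddCommGroup E] [InnerProductSpace 𝕜 E]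
    (M : Submodule 𝕜 E) : Prop :=
  IsCompl M Mᗮ

variable (𝕜) in
theorem exists_isMONS (E : Type*) [NormedAddCommGroup E] [InnerProductSpace 𝕜 E] :
    ∃ A : Set E, IsMONS 𝕜 A := by
  obtain ⟨A, -, hA, hmax⟩ := exists_maximal_orthonormal (𝕜 := 𝕜) (E := E) (s := ∅)
    (orthonormal_empty 𝕜 E)
  refine ⟨A, hA, fun x hx => ?_⟩
  have h := (maximal_orthonormal_iff_orthogonalComplement_eq_bot hA).1 hmax
  have hx' : x ∈ (Submodule.span 𝕜 A)ᗮ := by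
    rw [Submodule.mem_orthogonal]
    intro u hu
    induction hu using Submodule.span_induction with
    | mem a ha => exact hx a ha
    | zero => simp
    | add a b _ _ ha hb => rw [inner_add_left, ha, hb, add_zero]
    | smul c a _ ha => rw [inner_smul_left, ha, mul_zero]
  rw [h] at hx'
  simpa using hx'

theorem IsMONS.mk_le {E : Type*} [NormedAddCommGroup E] [InnerProductSpace 𝕜 E] {A B : Set E}
    (hA : IsMONS 𝕜 A) (hB : IsMONS 𝕜 B) : #B ≤ #A := by
  by_cases hfin : A.Finite
  · have : FiniteDimensional 𝕜 (Submodule.span 𝕜 A) := FiniteDimensional.span_of_finite 𝕜 hfin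
    have hbot : (Submodule.span 𝕜 A)ᗮ = ⊥ := by
      rw [eq_bot_iff]
      intro x hx
      have := hA.2 x fun a ha =>
        (Submodule.mem_orthogonal _ _).1 hx a (Submodule.subset_span ha)
      simp [this]
    have htop : Submodule.span 𝕜 A = ⊤ := Submodule.orthogonal_eq_bot_iff.1 hbot
    calc #B ≤ Module.rank 𝕜 E := hB.1.linearIndependent.cardinal_le_rank
      _ = Module.rank 𝕜 (Submodule.span 𝕜 A) := by rw [htop, rank_top]
      _ ≤ #A := rank_span_le A
  · have hinf : Infinite A := Set.infinite_coe_iff.2 hfin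
    have hcount : ∀ a : A, {b : B | ⟪(b : E), (a : E)⟫_𝕜 ≠ 0}.Countable := by
      intro a
      refine (hB.1.inner_products_summable (a : E)).countable_support.mono ?_
      intro b hb
      simpa using hb
    have hcov : (Set.univ : Set B) = ⋃ a : A, {b : B | ⟪(b : E), (a : E)⟫_𝕜 ≠ 0} := by
      refine (Set.eq_univ_of_forall fun b => ?_).symm
      by_contra hb
      have hb0 : (b : E) = 0 := hA.2 _ fun a ha => by
        by_contra hne
        refine hb (Set.mem_iUnion.2 ⟨⟨a, ha⟩, fun h0 => hne ?_⟩)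
        exact inner_eq_zero_symm.1 h0
      exact hB.1.ne_zero b hb0
    calc #B = #(Set.univ : Set B) := Cardinal.mk_univ.symm
      _ = #(⋃ a : A, {b : B | ⟪(b : E), (a : E)⟫_𝕜 ≠ 0}) := by rw [← hcov]
      _ ≤ #A * ⨆ a : A, #{b : B | ⟪(b : E), (a : E)⟫_𝕜 ≠ 0} := Cardinal.mk_iUnion_le _
      _ ≤ #A * ℵ₀ := by
        gcongr
        exact ciSup_le' fun a => (hcount a).le_aleph0
      _ = #A := Cardinal.mul_aleph0_eq (Cardinal.aleph0_le_mk A)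

theorem IsMONS.mk_eq_orthDim {E : Type*} [NormedAddCommGroup E] [InnerProductSpace 𝕜 E]
    {A : Set E} (hA : IsMONS 𝕜 A) : #A = orthDim 𝕜 E := by
  obtain ⟨B, hB, hBc⟩ : orthDim 𝕜 E ∈ {c : Cardinal | ∃ A : Set E, IsMONS 𝕜 A ∧ #A = c} :=
    csInf_mem ⟨#A, A, hA, rfl⟩
  rw [← hBc]
  exact le_antisymm (hB.mk_le hA) (hA.mk_le hB)

end Defs

/-!
Transfinite recursion along a well-order of type at most `2 ^ ℵ₀` chooses linearly independent
vectors `x A ∈ A` and `y A ∈ Aᗮ`: there are at most `2 ^ ℵ₀` closed separable subspaces, while each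
`A` and each `Aᗮ` is an infinite-dimensional Hilbert space, hence has algebraic dimension at least
`2 ^ ℵ₀`. Take `f` equal to `1` on all these vectors and `S = ker f`.

No orthocomplement of a separable subspace lies in `S`, and this makes `S ⊓ Bᗮ` dense in `Bᗮ` for
every closed separable `B`; the case `B = ⊥` is the density of `S`. If `M` splits in `S` and `B` is
the closed span of a countable maximal orthonormal system of `M`, then `Mᗮ` consists of the vectors
of `S` orthogonal to `B`, so `M ≤ (S ⊓ Bᗮ)ᗮ = B` and `S = (S ⊓ B) ⊔ (S ⊓ Bᗮ)`. For a hyperplane this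
forces `B ≤ S` or `Bᗮ ≤ S`, so `B` is finite-dimensional, and `M` with it.
-/

open Cardinal TopologicalSpace

universe u v

section LinearAlgebra

variable {K : Type*} {ι : Type u} {E : Type v} [DivisionRing K] [AddCommGroup E] [Module K E]

theorem linearIndependent_of_notMem_span_image_Iio [LinearOrder ι] {v : ι → E}
    (hv : ∀ i, v i ∉ Submodule.span K (v '' Set.Iio i)) : LinearIndependent K v := by
  rw [linearIndependent_iff_finset_linearIndependent]
  intro s
  change LinearIndepOn K v (s : Set ι)
  induction s using Finset.induction_on_max with
  | empty => simp
  | insert a s ha ih =>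
    rw [Finset.coe_insert, linearIndepOn_insert fun h => lt_irrefl a (ha a h)]
    exact ⟨ih, fun h => hv a (Submodule.span_mono (Set.image_mono ha) h)⟩

theorem exists_linearIndependent_mem_of_mk_Iio_lt_rank [LinearOrder ι] [WellFoundedLT ι]
    {V : ι → Submodule K E}
    (hV : ∀ i, lift.{v} #(Set.Iio i) < lift.{u} (Module.rank K (V i))) :
    ∃ v : ι → E, LinearIndependent K v ∧ ∀ i, v i ∈ V i := by
  have exists_next (i : ι) (w : ∀ j, j < i → E) :
      ∃ x ∈ V i, x ∉ Submodule.span K (Set.range fun j : Set.Iio i => w j j.2) := by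
    refine SetLike.not_le_iff_exists.1 fun hle => (hV i).not_ge ?_
    exact (lift_le.2 ((Submodule.rank_mono hle).trans (rank_span_le _))).trans mk_range_le_lift
  choose next hmem hnotMem using exists_next
  let v : ι → E := WellFoundedLT.fix next
  have hv (i : ι) : v i = next i fun j _ => v j := WellFoundedLT.fix_eq next i
  refine ⟨v, linearIndependent_of_notMem_span_image_Iio fun i => ?_, fun i => hv i ▸ hmem i _⟩
  rw [Set.image_eq_range, hv i]
  exact hnotMem i fun j _ => v j

theorem exists_linearIndependent_mem_of_mk_le_rank {V : ι → Submodule K E}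
    (hV : ∀ i, lift.{v} #ι ≤ lift.{u} (Module.rank K (V i))) :
    ∃ v : ι → E, LinearIndependent K v ∧ ∀ i, v i ∈ V i := by
  obtain ⟨_, _, hord⟩ := exists_ord_eq_type_lt ι
  exact exists_linearIndependent_mem_of_mk_Iio_lt_rank fun i =>
    (lift_lt.2 (mk_Iio_lt i hord)).trans_le (hV i)

theorem exists_linearMap_apply_eq {F : Type*} [AddCommGroup F] [Module K F] {v : ι → E}
    (hv : LinearIndependent K v) (c : ι → F) : ∃ f : E →ₗ[K] F, ∀ i, f (v i) = c i := by
  obtain ⟨f, hf⟩ := LinearMap.exists_extend ((Module.Basis.span hv).constr ℕ c)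
  refine ⟨f, fun i => ?_⟩
  have hfi := LinearMap.congr_fun hf (Module.Basis.span hv i)
  rwa [Module.Basis.constr_basis, LinearMap.comp_apply, Submodule.subtype_apply,
    Module.Basis.span_apply] at hfi

theorem le_ker_or_le_ker_of_ker_le_sup {f : E →ₗ[K] K} {B C : Submodule K E} (hBC : Disjoint B C)
    (h : LinearMap.ker f ≤ (LinearMap.ker f ⊓ B) ⊔ (LinearMap.ker f ⊓ C)) :
    B ≤ LinearMap.ker f ∨ C ≤ LinearMap.ker f := by
  by_contra! hcon
  obtain ⟨x, hxB, hfx⟩ := SetLike.not_le_iff_exists.1 hcon.1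
  obtain ⟨y, hyC, hfy⟩ := SetLike.not_le_iff_exists.1 hcon.2
  rw [LinearMap.mem_ker] at hfy
  have hker : x - (f x / f y) • y ∈ LinearMap.ker f := by simp [hfy]
  obtain ⟨b, ⟨hfb, hbB⟩, c, ⟨-, hcC⟩, hbc⟩ := Submodule.mem_sup.1 (h hker)
  have hxb : x - b = c + (f x / f y) • y := by
    rw [sub_eq_iff_eq_add', ← add_assoc, hbc, sub_add_cancel]
  have hzero : x - b = 0 := Submodule.disjoint_def.1 hBC _ (B.sub_mem hxB hbB)
    (hxb ▸ C.add_mem hcC (C.smul_mem _ hyC))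
  exact hfx (sub_eq_zero.1 hzero ▸ hfb)

theorem rank_quotient_ker_eq_one {f : E →ₗ[K] K} (hf : f ≠ 0) :
    Module.rank K (E ⧸ LinearMap.ker f) = 1 := by
  simpa using (f.quotKerEquivOfSurjective (f.surjective hf)).lift_rank_eq

theorem linearIndependent_fun_pow (R : Type*) [CommRing R] [IsDomain R] :
    LinearIndependent R fun (t : R) (n : ℕ) => t ^ n :=
  (linearIndependent_monoidHom (Multiplicative ℕ) R).comp (powersHom R) (powersHom R).injective

end LinearAlgebra

section Cardinality

theorem mk_closure_le_power_aleph0 {X : Type*} [TopologicalSpace X] [FrechetUrysohnSpace X]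
    [T2Space X] (s : Set X) : #(closure s) ≤ #s ^ ℵ₀ := by
  choose a has hax using fun x : closure s => mem_closure_iff_seq_limit.1 x.2
  let seq (x : closure s) (n : ℕ) : s := ⟨a x n, has x n⟩
  have hinj : Function.Injective seq := fun x y hxy => by
    have hxy' : a x = a y := funext fun n => congrArg Subtype.val (congrFun hxy n)
    exact Subtype.ext (tendsto_nhds_unique (hax x) (hxy' ▸ hax y))
  simpa using mk_le_of_injective hinj

theorem mk_span_le {R : Type u} {E : Type v} [Semiring R] [AddCommMonoid E] [Module R E]
    (s : Set E) : lift.{u} #(Submodule.span R s) ≤ max ℵ₀ (max (lift.{u} #s) (lift.{v} #R)) := by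
  classical
  let comb : (s →₀ R) →ₗ[R] E := Finsupp.linearCombination R Subtype.val
  have hcomb : LinearMap.range comb = Submodule.span R s := by
    rw [Finsupp.range_linearCombination, Subtype.range_coe]
  calc lift.{u} #(Submodule.span R s) = lift.{u} #(Set.range comb) := by
        rw [← hcomb]; rfl
    _ ≤ #(s →₀ R) := by
        rw [← lift_id'.{v, u} #(s →₀ R), ← lift_umax.{v, u}]
        exact mk_range_le_lift
    _ ≤ #(Finset (s × R)) := mk_le_of_injective (Finsupp.graph_injective s R)
    _ ≤ #(List (s × R)) := mk_le_of_surjective List.toFinset_surjective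
    _ ≤ max ℵ₀ #(s × R) := mk_list_le_max _
    _ ≤ max ℵ₀ (max (lift.{u} #s) (lift.{v} #R)) := by
        rw [mk_prod, max_comm _ (max _ _)]
        exact max_le (le_max_right _ _) (mul_le_max _ _)

theorem mk_le_continuum_of_rclike (𝕜 : Type*) [RCLike 𝕜] : #𝕜 ≤ 𝔠 := by
  have hinj : Function.Injective fun z : 𝕜 => (RCLike.re z, RCLike.im z) := fun _ _ h =>
    RCLike.ext (congrArg Prod.fst h) (congrArg Prod.snd h)
  simpa [mk_real] using lift_mk_le_lift_mk_of_injective hinj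

end Cardinality

section Hyperplane

theorem not_bounded_of_dense_ker {R E F : Type*} [Ring R] [SeminormedAddCommGroup E] [Module R E]
    [NormedAddCommGroup F] [Module R F] {f : E →ₗ[R] F} (hf : f ≠ 0)
    (hdense : Dense (LinearMap.ker f : Set E)) : ¬ ∃ C : ℝ, ∀ v : E, ‖f v‖ ≤ C * ‖v‖ := by
  intro hbdd
  have hclosed := (f.mkContinuousOfExistsBound hbdd).isClosed_ker
  have huniv : (LinearMap.ker f : Set E) = Set.univ := hclosed.closure_eq ▸ hdense.closure_eq
  exact hf (LinearMap.ker_eq_top.1 (SetLike.coe_injective huniv))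

end Hyperplane

section SeparableSubmodule

variable {R E : Type*} [Semiring R] [AddCommMonoid E] [Module R E] [TopologicalSpace E]

theorem isSeparable_bot : IsSeparable ((⊥ : Submodule R E) : Set E) := by
  simpa only [Submodule.bot_coe] using (Set.finite_singleton (0 : E)).isSeparable

theorem isSeparable_sup [ContinuousAdd E] [TopologicalSpace R] [SeparableSpace R]
    [ContinuousSMul R E] {A B : Submodule R E} (hA : IsSeparable (A : Set E))
    (hB : IsSeparable (B : Set E)) : IsSeparable ((A ⊔ B : Submodule R E) : Set E) := by
  have := (hA.union hB).span (R := R)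
  rwa [Submodule.span_union, Submodule.span_eq, Submodule.span_eq] at this

end SeparableSubmodule

section InnerProductSpace

variable {𝕜 E : Type*} [RCLike 𝕜] [NormedAddCommGroup E] [InnerProductSpace 𝕜 E]

theorem mem_orthogonal_span_iff {s : Set E} {x : E} :
    x ∈ (Submodule.span 𝕜 s)ᗮ ↔ ∀ a ∈ s, ⟪a, x⟫_𝕜 = 0 := by
  rw [← Submodule.span_singleton_le_iff_mem, ← Submodule.isOrtho_iff_le, Submodule.isOrtho_comm,
    Submodule.isOrtho_span]
  simp only [Set.mem_singleton_iff, forall_eq]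

theorem IsMONS.orthogonal_span_eq_bot {A : Set E} (hA : IsMONS 𝕜 A) :
    (Submodule.span 𝕜 A)ᗮ = ⊥ :=
  eq_bot_iff.2 fun x hx => hA.2 x (mem_orthogonal_span_iff.1 hx)

theorem IsMONS.finiteDimensional {A : Set E} (hA : IsMONS 𝕜 A) (hfin : A.Finite) :
    FiniteDimensional 𝕜 E := by
  have : FiniteDimensional 𝕜 (Submodule.span 𝕜 A) := FiniteDimensional.span_of_finite 𝕜 hfin
  have htop := Submodule.orthogonal_eq_bot_iff.1 hA.orthogonal_span_eq_bot
  exact Module.finite_def.2 (htop ▸ Module.Finite.iff_fg.1 this)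

theorem exists_orthonormal_nat (h : ¬ FiniteDimensional 𝕜 E) : ∃ e : ℕ → E, Orthonormal 𝕜 e := by
  obtain ⟨A, hA⟩ := exists_isMONS 𝕜 E
  have : Infinite A := Set.infinite_coe_iff.2 fun hfin => h (hA.finiteDimensional hfin)
  let g := Infinite.natEmbedding A
  exact ⟨fun n => (g n : E), hA.1.comp g g.injective⟩

theorem inner_tsum_smul_of_orthonormal {ι : Type*} {e : ι → E} (he : Orthonormal 𝕜 e) {a : ι → 𝕜}
    (ha : Summable fun i => a i • e i) (k : ι) : ⟪e k, ∑' i, a i • e i⟫_𝕜 = a k := by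
  classical
  calc ⟪e k, ∑' i, a i • e i⟫_𝕜 = ∑' i, ⟪e k, a i • e i⟫_𝕜 := (innerSL 𝕜 (e k)).map_tsum ha
    _ = a k := by simp [orthonormal_iff_ite.1 he, inner_smul_right]

theorem linearIndependent_tsum_pow_smul [CompleteSpace E] {e : ℕ → E} (he : Orthonormal 𝕜 e) :
    LinearIndependent 𝕜 fun t : Metric.ball (0 : 𝕜) 1 => ∑' n, (t : 𝕜) ^ n • e n := by
  have hsum (t : Metric.ball (0 : 𝕜) 1) : Summable fun n => (t : 𝕜) ^ n • e n := by
    refine .of_norm ?_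
    simpa [norm_smul, he.1] using mem_ball_zero_iff.1 t.2
  let coeff : E →ₗ[𝕜] (ℕ → 𝕜) := LinearMap.pi fun n => innerₛₗ 𝕜 (e n)
  refine LinearIndependent.of_comp coeff ?_
  have hcoeff : coeff ∘ (fun t : Metric.ball (0 : 𝕜) 1 => ∑' n, (t : 𝕜) ^ n • e n) =
      (fun t n => t ^ n) ∘ Subtype.val :=
    funext₂ fun t n => inner_tsum_smul_of_orthonormal he (hsum t) n
  rw [hcoeff]
  exact (linearIndependent_fun_pow 𝕜).comp _ Subtype.val_injective

theorem continuum_le_rank [CompleteSpace E] (h : ¬ FiniteDimensional 𝕜 E) :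
    𝔠 ≤ Module.rank 𝕜 E := by
  obtain ⟨e, he⟩ := exists_orthonormal_nat h
  have hball : 𝔠 ≤ #(Metric.ball (0 : 𝕜) 1) :=
    continuum_le_cardinal_of_isOpen 𝕜 Metric.isOpen_ball ⟨0, by simp⟩
  simpa using (lift_le.2 hball).trans (linearIndependent_tsum_pow_smul he).cardinal_lift_le_rank

theorem countable_notMem_orthogonal {ι : Type*} {e : ι → E} (he : Orthonormal 𝕜 e)
    {A : Submodule 𝕜 E} (hA : IsSeparable (A : Set E)) : {i | e i ∉ Aᗮ}.Countable := by
  obtain ⟨C, hC, hAC⟩ := hA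
  have hcover : {i | e i ∉ Aᗮ} ⊆ ⋃ c ∈ C, {i | ⟪e i, c⟫_𝕜 ≠ 0} := by
    refine fun i => not_imp_comm.1 fun hi => ?_
    simp only [Set.mem_iUnion, Set.mem_ofPred_eq, not_exists, not_not] at hi
    have hclosed : IsClosed {x : E | ⟪e i, x⟫_𝕜 = 0} :=
      isClosed_eq (by fun_prop) continuous_const
    exact (Submodule.mem_orthogonal' _ _).2 fun a ha => closure_minimal hi hclosed (hAC ha)
  refine (hC.biUnion fun c _ => ?_).mono hcover
  simpa [Function.support] using (he.inner_products_summable c).countable_support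

theorem not_finiteDimensional_orthogonal (hE : ℵ₀ < orthDim 𝕜 E) {A : Submodule 𝕜 E}
    (hA : IsSeparable (A : Set E)) : ¬ FiniteDimensional 𝕜 Aᗮ := by
  intro hfin
  obtain ⟨D, hD⟩ := exists_isMONS 𝕜 E
  have hli : LinearIndependent 𝕜 fun d : {d : D | (d : E) ∈ Aᗮ} => (⟨d, d.2⟩ : Aᗮ) :=
    .of_comp Aᗮ.subtype (hD.1.linearIndependent.comp _ Subtype.val_injective)
  have hmem : {d : D | (d : E) ∈ Aᗮ}.Countable :=
    (Set.finite_coe_iff.1 hli.finite_of_isNoetherian).countable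
  have huniv : (Set.univ : Set D).Countable :=
    (hmem.union (countable_notMem_orthogonal hD.1 hA)).mono fun _ _ => em _
  rw [← hD.mk_eq_orthDim, ← mk_univ] at hE
  exact hE.not_ge huniv.le_aleph0

theorem mk_le_continuum_of_orthDim_le [CompleteSpace E] (h : orthDim 𝕜 E ≤ 𝔠) : #E ≤ 𝔠 := by
  obtain ⟨D, hD⟩ := exists_isMONS 𝕜 E
  have hspan : #(Submodule.span 𝕜 D) ≤ 𝔠 := by
    refine lift_le.1 ((mk_span_le D).trans ?_)
    rw [hD.mk_eq_orthDim]
    simpa only [lift_continuum, lift_le_continuum, max_le_iff] using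
      ⟨aleph0_le_continuum, h, mk_le_continuum_of_rclike 𝕜⟩
  have hdense : closure (Submodule.span 𝕜 D : Set E) = Set.univ :=
    Submodule.dense_iff_topologicalClosure_eq_top.2
      (Submodule.topologicalClosure_eq_top_iff.2 hD.orthogonal_span_eq_bot) |>.closure_eq
  calc #E = #(closure (Submodule.span 𝕜 D : Set E)) := by rw [hdense, mk_univ]
    _ ≤ #(Submodule.span 𝕜 D) ^ ℵ₀ := mk_closure_le_power_aleph0 _
    _ ≤ 𝔠 ^ ℵ₀ := power_le_power_right hspan
    _ = 𝔠 := continuum_power_aleph0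

variable (𝕜 E) in
/-- The family `𝓤` of closed, separable, infinite-dimensional subspaces, as a subtype that unfolds
to the index type of the theorem. -/
abbrev SepSubspace : Type _ :=
  {A : Submodule 𝕜 E // IsClosed (A : Set E) ∧ IsSeparable (A : Set E) ∧ ¬ FiniteDimensional 𝕜 A}

theorem SepSubspace.mk_le_power_aleph0 : #(SepSubspace 𝕜 E) ≤ #E ^ ℵ₀ := by
  have hseq (A : SepSubspace 𝕜 E) : ∃ s : ℕ → E, (A.1 : Set E) = closure (Set.range s) := by
    obtain ⟨A, hclosed, hsep, -⟩ := A
    obtain ⟨C, hCA, hC, hAC⟩ := hsep.exists_countable_dense_subset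
    have hne : C.Nonempty := closure_nonempty_iff.1 ⟨0, hAC A.zero_mem⟩
    obtain ⟨s, rfl⟩ := hC.exists_eq_range hne
    exact ⟨s, hAC.antisymm (hclosed.closure_subset_iff.2 hCA)⟩
  choose s hs using hseq
  have hinj : Function.Injective s := fun A B hAB =>
    Subtype.ext (SetLike.coe_injective (by rw [hs, hs, hAB]))
  simpa using mk_le_of_injective hinj

theorem SepSubspace.exists_ge (hE : ¬ FiniteDimensional 𝕜 E) {A : Submodule 𝕜 E}
    (hA : IsSeparable (A : Set E)) : ∃ B : SepSubspace 𝕜 E, A ≤ B.1 := by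
  obtain ⟨e, he⟩ := exists_orthonormal_nat hE
  let C := Submodule.span 𝕜 (Set.range e)
  have hC : IsSeparable (C : Set E) := (Set.countable_range e).isSeparable.span
  have hC_inf : ¬ FiniteDimensional 𝕜 C := fun _ =>
    not_finite_iff_infinite.2 inferInstance
      (linearIndependent_span he.linearIndependent).finite_of_isNoetherian
  have hAC : A ⊔ C ≤ (A ⊔ C).topologicalClosure := Submodule.le_topologicalClosure _
  refine ⟨⟨(A ⊔ C).topologicalClosure, Submodule.isClosed_topologicalClosure _, ?_, fun _ =>
    hC_inf (Submodule.finiteDimensional_of_le (le_sup_right.trans hAC))⟩, le_sup_left.trans hAC⟩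
  exact (isSeparable_sup hA hC).closure

theorem SepSubspace.exists_linearIndependent_mem [CompleteSpace E] (h₀ : ℵ₀ < orthDim 𝕜 E)
    (h₁ : orthDim 𝕜 E ≤ 𝔠) : ∃ x y : SepSubspace 𝕜 E → E,
      LinearIndependent 𝕜 (Sum.elim x y) ∧ ∀ A, x A ∈ A.1 ∧ y A ∈ A.1ᗮ := by
  let V : SepSubspace 𝕜 E ⊕ SepSubspace 𝕜 E → Submodule 𝕜 E :=
    Sum.elim (fun A => A.1) fun A => A.1ᗮ
  have hV (i) : 𝔠 ≤ Module.rank 𝕜 (V i) := by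
    rcases i with A | A
    · have : CompleteSpace A.1 := A.2.1.completeSpace_coe
      exact continuum_le_rank (E := A.1) A.2.2.2
    · exact continuum_le_rank (E := (A.1ᗮ : Submodule 𝕜 E))
        (not_finiteDimensional_orthogonal h₀ A.2.2.1)
  have hmk : #(SepSubspace 𝕜 E) ≤ 𝔠 :=
    calc #(SepSubspace 𝕜 E) ≤ #E ^ ℵ₀ := SepSubspace.mk_le_power_aleph0
      _ ≤ 𝔠 ^ ℵ₀ := power_le_power_right (mk_le_continuum_of_orthDim_le h₁)
      _ = 𝔠 := continuum_power_aleph0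
  have hmk_sum : #(SepSubspace 𝕜 E ⊕ SepSubspace 𝕜 E) ≤ 𝔠 := by
    simpa using (add_le_add hmk hmk).trans_eq continuum_add_self
  obtain ⟨v, hv, hvV⟩ := exists_linearIndependent_mem_of_mk_le_rank fun i =>
    lift_le.2 (hmk_sum.trans (hV i))
  exact ⟨v ∘ .inl, v ∘ .inr, by rwa [Sum.elim_comp_inl_inr],
    fun A => ⟨hvV (.inl A), hvV (.inr A)⟩⟩

variable {f : E →ₗ[𝕜] 𝕜}

theorem orthogonal_ker_inf_orthogonal_le
    (hf : ∀ A : Submodule 𝕜 E, IsSeparable (A : Set E) → ¬ Aᗮ ≤ LinearMap.ker f)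
    {B : Submodule 𝕜 E} [B.HasOrthogonalProjection] (hB : IsSeparable (B : Set E)) :
    (LinearMap.ker f ⊓ Bᗮ)ᗮ ≤ B := by
  intro x hx
  obtain ⟨b, hb, c, hc, rfl⟩ := B.exists_add_mem_mem_orthogonal x
  have hsep : IsSeparable ((B ⊔ 𝕜 ∙ c : Submodule 𝕜 E) : Set E) :=
    isSeparable_sup hB (Set.finite_singleton c).isSeparable.span
  obtain ⟨y, hy, hfy⟩ := SetLike.not_le_iff_exists.1 (hf _ hsep)
  rw [← Submodule.inf_orthogonal, Submodule.mem_inf,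
    Submodule.mem_orthogonal_singleton_iff_inner_right] at hy
  rw [LinearMap.mem_ker] at hfy
  -- Correcting `c` by a multiple of `y` moves it into `ker f` without changing `⟪c, c⟫`.
  let s := c - (f c / f y) • y
  have hs : s ∈ LinearMap.ker f ⊓ Bᗮ :=
    ⟨by simp [s, hfy], Submodule.sub_mem _ hc (Submodule.smul_mem _ _ hy.1)⟩
  have hcc : ⟪c, c⟫_𝕜 = 0 :=
    calc ⟪c, c⟫_𝕜 = ⟪c, s⟫_𝕜 := by simp [s, inner_sub_right, inner_smul_right, hy.2]
      _ = ⟪b + c, s⟫_𝕜 := by rw [inner_add_left, hs.2 b hb, zero_add]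
      _ = 0 := (Submodule.mem_orthogonal' _ _).1 hx s hs
  rwa [inner_self_eq_zero.1 hcc, add_zero]

theorem dense_ker_of_orthogonal_not_le [CompleteSpace E]
    (hf : ∀ A : Submodule 𝕜 E, IsSeparable (A : Set E) → ¬ Aᗮ ≤ LinearMap.ker f) :
    Dense (LinearMap.ker f : Set E) := by
  rw [Submodule.dense_iff_topologicalClosure_eq_top, Submodule.topologicalClosure_eq_top_iff,
    eq_bot_iff]
  simpa using orthogonal_ker_inf_orthogonal_le hf isSeparable_bot

theorem IsSplitting.mem_orthogonal_of_isMONS {M : Submodule 𝕜 E} (hM : IsSplitting M) {D : Set M}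
    (hD : IsMONS 𝕜 D) {x : E} (hx : ∀ d ∈ D, ⟪(d : E), x⟫_𝕜 = 0) : x ∈ Mᗮ := by
  obtain ⟨m, hm, n, hn, rfl⟩ := Submodule.mem_sup.1 (hM.sup_eq_top ▸ Submodule.mem_top (x := x))
  have hm0 : (⟨m, hm⟩ : M) = 0 := hD.2 _ fun d hd => by
    simpa [inner_add_right, hn d d.2] using hx d hd
  have hm0' : m = 0 := congrArg Subtype.val hm0
  rwa [hm0', zero_add]

theorem IsSplitting.exists_isSeparable_map_le [CompleteSpace E]
    (hf : ∀ A : Submodule 𝕜 E, IsSeparable (A : Set E) → ¬ Aᗮ ≤ LinearMap.ker f)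
    {M : Submodule 𝕜 (LinearMap.ker f)} (hM : IsSplitting M) (hdim : orthDim 𝕜 M ≤ ℵ₀) :
    ∃ B : Submodule 𝕜 E, IsClosed (B : Set E) ∧ IsSeparable (B : Set E) ∧
      M.map (LinearMap.ker f).subtype ≤ B ∧ Mᗮ.map (LinearMap.ker f).subtype ≤ Bᗮ := by
  obtain ⟨D, hD⟩ := exists_isMONS 𝕜 M
  have hD_countable : D.Countable := mk_le_aleph0_iff.1 (hD.mk_eq_orthDim.trans_le hdim)
  let D' : Set E := (fun d : M => ((d : LinearMap.ker f) : E)) '' D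
  let B := (Submodule.span 𝕜 D').topologicalClosure
  have hB_closed : IsClosed (B : Set E) := Submodule.isClosed_topologicalClosure _
  have hB_sep : IsSeparable (B : Set E) := (hD_countable.image _).isSeparable.span.closure
  have : CompleteSpace B := hB_closed.completeSpace_coe
  have mem_Borth {x : E} : x ∈ Bᗮ ↔ ∀ d ∈ D, ⟪((d : LinearMap.ker f) : E), x⟫_𝕜 = 0 := by
    rw [Submodule.orthogonal_closure, mem_orthogonal_span_iff, Set.forall_mem_image]
  refine ⟨B, hB_closed, hB_sep, ?_, ?_⟩
  · refine le_trans ?_ (orthogonal_ker_inf_orthogonal_le hf hB_sep)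
    rintro _ ⟨m, hm, rfl⟩
    refine (Submodule.mem_orthogonal' _ _).2 fun s hs => ?_
    have hsM : (⟨s, hs.1⟩ : LinearMap.ker f) ∈ Mᗮ :=
      hM.mem_orthogonal_of_isMONS hD (mem_Borth.1 hs.2)
    exact hsM m hm
  · rintro _ ⟨n, hn, rfl⟩
    exact mem_Borth.2 fun d _ => hn d d.2

theorem IsSplitting.finiteDimensional [CompleteSpace E]
    (hmem : ∀ A : SepSubspace 𝕜 E, ¬ A.1 ≤ LinearMap.ker f)
    (hf : ∀ A : Submodule 𝕜 E, IsSeparable (A : Set E) → ¬ Aᗮ ≤ LinearMap.ker f)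
    {M : Submodule 𝕜 (LinearMap.ker f)} (hM : IsSplitting M) (hdim : orthDim 𝕜 M ≤ ℵ₀) :
    FiniteDimensional 𝕜 M := by
  obtain ⟨B, hB_closed, hB_sep, hMB, hMB'⟩ := hM.exists_isSeparable_map_le hf hdim
  have hker : LinearMap.ker f ≤ (LinearMap.ker f ⊓ B) ⊔ (LinearMap.ker f ⊓ Bᗮ) :=
    calc LinearMap.ker f = (M ⊔ Mᗮ).map (LinearMap.ker f).subtype := by
          rw [hM.sup_eq_top, Submodule.map_subtype_top]
      _ = M.map (LinearMap.ker f).subtype ⊔ Mᗮ.map (LinearMap.ker f).subtype :=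
          Submodule.map_sup _ _ _
      _ ≤ (LinearMap.ker f ⊓ B) ⊔ (LinearMap.ker f ⊓ Bᗮ) :=
          sup_le_sup (le_inf (Submodule.map_subtype_le _ _) hMB)
            (le_inf (Submodule.map_subtype_le _ _) hMB')
  have hB_le : B ≤ LinearMap.ker f :=
    (le_ker_or_le_ker_of_ker_le_sup B.orthogonal_disjoint hker).resolve_right (hf B hB_sep)
  have hB_fin : FiniteDimensional 𝕜 B :=
    by_contra fun hB_inf => hmem ⟨B, hB_closed, hB_sep, hB_inf⟩ hB_le
  have : FiniteDimensional 𝕜 (M.map (LinearMap.ker f).subtype) :=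
    Submodule.finiteDimensional_of_le hMB
  exact ((LinearMap.ker f).equivSubtypeMap M).symm.finiteDimensional

end InnerProductSpace

theorem mainTheorem9_general {𝕜 E : Type*} [RCLike 𝕜] [NormedAddCommGroup E]
    [InnerProductSpace 𝕜 E] [CompleteSpace E] (h₀ : ℵ₀ < orthDim 𝕜 E)
    (h₁ : orthDim 𝕜 E ≤ 2 ^ ℵ₀) :
    ∃ S : Submodule 𝕜 E,
      Dense (S : Set E) ∧ Module.rank 𝕜 (E ⧸ S) = 1 ∧
      (∃ f : E →ₗ[𝕜] 𝕜, (¬ ∃ C : ℝ, ∀ v : E, ‖f v‖ ≤ C * ‖v‖) ∧ S = LinearMap.ker f) ∧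
      (∃ x y : SepSubspace 𝕜 E → E, LinearIndependent 𝕜 (Sum.elim x y) ∧
        ∀ A, (x A ∈ A.1 ∧ x A ∉ S) ∧ (y A ∈ A.1ᗮ ∧ y A ∉ S)) ∧
      ∀ M : Submodule 𝕜 S, IsSplitting M → orthDim 𝕜 M ≤ ℵ₀ → FiniteDimensional 𝕜 M := by
  obtain ⟨x, y, hxy, hmem⟩ := SepSubspace.exists_linearIndependent_mem h₀ h₁
  obtain ⟨f, hf⟩ := exists_linearMap_apply_eq hxy fun _ => (1 : 𝕜)
  have hx (A) : x A ∉ LinearMap.ker f := by simpa using hf (.inl A) ▸ one_ne_zero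
  have hy (A) : y A ∉ LinearMap.ker f := by simpa using hf (.inr A) ▸ one_ne_zero
  have hE : ¬ FiniteDimensional 𝕜 E := fun _ =>
    not_finiteDimensional_orthogonal h₀ isSeparable_bot inferInstance
  have horth (A : Submodule 𝕜 E) (hA : IsSeparable (A : Set E)) : ¬ Aᗮ ≤ LinearMap.ker f := by
    obtain ⟨B, hAB⟩ := SepSubspace.exists_ge hE hA
    exact fun hle => hy B (hle (Submodule.orthogonal_le hAB (hmem B).2))
  have hf0 : f ≠ 0 := fun h => horth ⊥ isSeparable_bot (by simp [h])
  have hdense := dense_ker_of_orthogonal_not_le horth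
  exact ⟨LinearMap.ker f, hdense, rank_quotient_ker_eq_one hf0,
    ⟨f, not_bounded_of_dense_ker hf0 hdense, rfl⟩,
    ⟨x, y, hxy, fun A => ⟨⟨(hmem A).1, hx A⟩, (hmem A).2, hy A⟩⟩,
    fun M hM hdim => hM.finiteDimensional (fun A hle => hx A (hle (hmem A).1)) horth hdim⟩

theorem mainTheorem9 {𝕜 : Type*} [RCLike 𝕜] {H : Type*} [NormedAddCommGroup H]
    [InnerProductSpace 𝕜 H] [CompleteSpace H] (hH : orthDim 𝕜 H = 2 ^ ℵ₀) :
    ∃ S : Submodule 𝕜 H,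
      -- `S` is a dense hyperplane, the kernel of an unbounded linear functional
      Dense (S : Set H) ∧ Module.rank 𝕜 (H ⧸ S) = 1 ∧
      (∃ f : H →ₗ[𝕜] 𝕜, (¬ ∃ C : ℝ, ∀ v : H, ‖f v‖ ≤ C * ‖v‖) ∧ S = LinearMap.ker f) ∧
      -- every closed separable infinite-dimensional `A` and its orthocomplement contain vectors
      -- outside `S`, and these can be chosen linearly independent
      (∃ x y : {A : Submodule 𝕜 H // IsClosed (A : Set H) ∧
            TopologicalSpace.IsSeparable (A : Set H) ∧ ¬ FiniteDimensional 𝕜 A} → H,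
        LinearIndependent 𝕜 (Sum.elim x y) ∧
        ∀ A, (x A ∈ A.1 ∧ x A ∉ S) ∧ (y A ∈ A.1ᗮ ∧ y A ∉ S)) ∧
      -- splitting subspaces of countable orthogonal dimension are finite-dimensional
      ∀ M : Submodule 𝕜 S, IsSplitting M → orthDim 𝕜 M ≤ ℵ₀ → FiniteDimensional 𝕜 M :=
  mainTheorem9_general (hH ▸ cantor ℵ₀) hH.le
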